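/- Let $n\ge 1$, $\omega=e^{2\pi i/n!}$ and $\hat\imath=\lceil\log_2 n\rceil$. Unitaries $U_0,\dots,U_{n-1}$ on $\mathbb{C}^d$ satisfy the promise of the Fourier promise problem with the factoradic labeling, with value $y\in\{0,\dots,n!-1\}$, if $\Pi_x=\omega^{xy}\,\Pi_0$ for all $x\in\{0,\dots,n!-1\}$. Here $\Pi_0=U_{n-1}\cdots U_1U_0$, and if $x=\sum_{k=1}^{n-1}a_k\,k!$ with $0\le a_k\le k$, then $\Pi_x$ is obtained from $\Pi_0$ by shifting first $U_1$ by $a_1$ steps to the right, then $U_2$ by $a_2$ steps, and so on up to $U_{n-1}$. The promise holds if and only if $U_jU_k=\omega^{k!\,y}\,U_kU_j$ for all $j<k$. Consider the following circuit, which does not depend on the $U_k$ or on $y$. It acts on $(n-1)\hat\imath$ control qubits $c_{k,i}$ ($1\le k\le n-1$, $1\le i\le\hat\imath$) and $2^{\hat\imath+1}-2$ target systems $\Psi_{2^i,j}$ of dimension $d$ ($1\le i\le\hat\imath$, $1\le j\le 2^i$). First, for $k=n-1,\dots,1$ and $i=1,\dots,\hat\imath$, the gate $U_k$ is applied to the system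 $\Psi_{2^i,j}$ with $j\equiv k \pmod{2^i}$, controlled on $c_{k,i}=1$; then $U_0$ is applied to every target system; then the controlled gates of the first part are repeated in reverse order, now controlled on $c_{k,i}=0$. A second circuit is obtained by adding auxiliary $d$-dimensional systems $a_1,\dots,a_{n-1}$ and replacing every controlled $U_k$ on $\Psi_{2^i,j}$ by a swap of $\Psi_{2^i,j}$ and $a_k$ with the same control, followed by $U_k$ on $a_k$, followed by the same controlled swap. 1. Each of the two circuits uses exactly $$Q=2(n-1)\hat\imath+2^{\hat\imath+1}-2<2(n-1)(\log_2 n+1)+4n-2$$ queries, and there is a constant $C$ with $Q\le C\,n\log_2 n$ for all $n\ge1$, so $Q=O(n\log n)$. The second circuit contains no controlled unknown unitaries. 2. For every $x\in\{0,\dots,n!-1\}$ there are bits $c^x_{k,i}$ with $x=\sum_{k=1}^{n-1}\sum_{i=1}^{\hat\imath}c^x_{k,i}\lceil k/2^i\rceil\,k!$. 3. If the promise holds, then for all bits $c=(c_{k,i})$, with $v(c)=\sum_{k,i}c_{k,i}\lceil k/2^i\rceil k!$, and all states $\Psi_{2^i,j}$ and $a_k$, the first circuit maps $$|c\rangle\otimes\bigotimes_{i,j}|\Psi_{2^i,j}\rangle\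 \mapsto\ \omega^{v(c)\,y}\,|c\rangle\otimes\bigotimes_{i,j}(\cdots U_{2\cdot2^i+j}U_{2^i+j}U_jU_0)|\Psi_{2^i,j}\rangle ,$$ and the second circuit acts in the same way and maps in addition $\bigotimes_k|a_k\rangle$ to $\bigotimes_k(U_k)^{\hat\imath}|a_k\rangle$. (Only the $U_m$ with $m\le n-1$ occur, and $U_0$ occurs once.) In particular, with $|x\rangle_c=|c^x\rangle$, the phase is $\omega^{xy}$ and the final target and auxiliary states do not depend on $x$. 4. Fix one representation $|x\rangle_c=|c^x\rangle$ as in 2 for every $x\in\{0,\dots,n!-1\}$. There is a unitary $F$ on the control qubits with $F|z\rangle_c=\frac{1}{\sqrt{n!}}\sum_{x=0}^{n!-1}\omega^{xz}|x\rangle_c$ for all $z\in\{0,\dots,n!-1\}$. If the promise holds, then for every such $F$, applying $F$ to the control qubits in the state $|0\rangle_c$, then either circuit, then $F^{-1}$ to the control qubits yields $|y\rangle_c$ on the control qubits, in a product with the final target (and auxiliary) states of 3. -/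

import Mathlib

open scoped Matrix Nat

noncomputable section

namespace FPP

/-! ## Quantum circuits with black boxes

The register consists of qubits indexed by `K` and of `d`-dimensional systems indexed by `S`.
A vector of the joint Hilbert space is given by its amplitudes in the computational basis. -/

/-- Vectors of the Hilbert space of the qubits `K` and the `d`-dimensional systems `S`. -/
abbrev State (K S : Type) (d : ℕ) : Type := (K → Bool) × (S → Fin d) → ℂ

/-- The product vector `|c⟩ ⊗ (⨂ s, ψ s)`, where `|c⟩` is a computational basis vector of the
qubits. -/
def productState {K S : Type} [Fintype K] [Fintype S] {d : ℕ}
    (c : K → Bool) (ψ : S → Fin d → ℂ) : State K S d :=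
  fun b => if b.1 = c then ∏ s, ψ s (b.2 s) else 0

/-- The operator `M` acting on the system `s` (and as the identity on everything else). -/
def onSystem {K S : Type} [DecidableEq S] {d : ℕ} (s : S) (M : Matrix (Fin d) (Fin d) ℂ) :
    State K S d →ₗ[ℂ] State K S d where
  toFun f := fun b => ∑ t, M (b.2 s) t * f (b.1, Function.update b.2 s t)
  map_add' f g := by
    funext b
    simp [mul_add, Finset.sum_add_distrib]
  map_smul' r f := by
    funext b
    simp only [Pi.smul_apply, smul_eq_mul, RingHom.id_apply, Finset.mul_sum]
    exact Finset.sum_congr rfl fun t _ => by ring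

/-- The operator `F` acting on the qubits (and as the identity on the systems). -/
def onQubits {K S : Type} [Fintype K] [DecidableEq K] {d : ℕ}
    (F : Matrix (K → Bool) (K → Bool) ℂ) : State K S d →ₗ[ℂ] State K S d where
  toFun f := fun b => ∑ c, F b.1 c * f (c, b.2)
  map_add' f g := by
    funext b
    simp [mul_add, Finset.sum_add_distrib]
  map_smul' r f := by
    funext b
    simp only [Pi.smul_apply, smul_eq_mul, RingHom.id_apply, Finset.mul_sum]
    exact Finset.sum_congr rfl fun t _ => by ring

/-- The exchange of the two systems `s` and `t`. -/
def swapSystems {K S : Type} [DecidableEq S] {d : ℕ} (s t : S) :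
    State K S d →ₗ[ℂ] State K S d :=
  LinearMap.funLeft ℂ ℂ fun b => (b.1, b.2 ∘ Equiv.swap s t)

/-- `A` controlled on the value `v` of the qubit `q`, that is `|v⟩⟨v| ⊗ A + |¬v⟩⟨¬v| ⊗ 1` for an
operator `A` on the systems. -/
def controlled {K S : Type} {d : ℕ} (q : K) (v : Bool) (A : State K S d →ₗ[ℂ] State K S d) :
    State K S d →ₗ[ℂ] State K S d where
  toFun f := fun b => if b.1 q = v then A f b else f b
  map_add' f g := by
    funext b
    by_cases h : b.1 q = v <;> simp [h]
  map_smul' r f := by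
    funext b
    by_cases h : b.1 q = v <;> simp [h]

/-- The elementary gates, where `n` black boxes `U_0, …, U_{n-1}` are available. -/
inductive Gate (n : ℕ) (K S : Type) : Type
  /-- The black box `U_k` applied to the system `s`. -/
  | query (k : Fin n) (s : S) : Gate n K S
  /-- The black box `U_k` applied to `s`, controlled on the value `v` of the qubit `q`. -/
  | ctrlQuery (q : K) (v : Bool) (k : Fin n) (s : S) : Gate n K S
  /-- The exchange of the systems `s` and `t`, controlled on the value `v` of the qubit `q`. -/
  | ctrlSwap (q : K) (v : Bool) (s t : S) : Gate n K S

/-- The number of calls of a black box in a gate. -/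
def Gate.queries {n : ℕ} {K S : Type} : Gate n K S → ℕ
  | .query _ _ => 1
  | .ctrlQuery _ _ _ _ => 1
  | .ctrlSwap _ _ _ _ => 0

/-- Does the gate control an unknown unitary? -/
def Gate.ControlsUnknown {n : ℕ} {K S : Type} : Gate n K S → Prop
  | .query _ _ => False
  | .ctrlQuery _ _ _ _ => True
  | .ctrlSwap _ _ _ _ => False

/-- The operator of a gate, once the black boxes are given. -/
def Gate.op {n : ℕ} {K S : Type} [DecidableEq S] {d : ℕ}
    (U : Fin n → Matrix.unitaryGroup (Fin d) ℂ) : Gate n K S → (State K S d →ₗ[ℂ] State K S d)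
  | .query k s => onSystem s (U k : Matrix (Fin d) (Fin d) ℂ)
  | .ctrlQuery q v k s => controlled q v (onSystem s (U k : Matrix (Fin d) (Fin d) ℂ))
  | .ctrlSwap q v s t => controlled q v (swapSystems s t)

/-- A causal circuit: gates in a fixed order, the head of the list being applied first.
It does not depend on the black boxes. -/
abbrev Circuit (n : ℕ) (K S : Type) : Type := List (Gate n K S)

/-- The query complexity of a circuit: the total number of black-box calls. -/
def Circuit.queries {n : ℕ} {K S : Type} (C : Circuit n K S) : ℕ :=
  (C.map Gate.queries).sum

/-- The operator of a circuit, once the black boxes are given. -/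
def Circuit.op {n : ℕ} {K S : Type} [DecidableEq S] {d : ℕ}
    (U : Fin n → Matrix.unitaryGroup (Fin d) ℂ) : Circuit n K S → (State K S d →ₗ[ℂ] State K S d)
  | [] => LinearMap.id
  | g :: C => Circuit.op U C ∘ₗ Gate.op U g

/-! ## The Fourier promise problem with the factoradic labeling -/

/-- `ω = exp (2 π i / n!)`. -/
def omega (n : ℕ) : ℂ := Complex.exp (2 * Real.pi * Complex.I / (n ! : ℂ))

/-- The operator product `U_{l₀} U_{l₁} ⋯` of a word `l = [l₀, l₁, …]`. -/
def wordProd {n d : ℕ} (U : Fin n → Matrix.unitaryGroup (Fin d) ℂ) (l : List (Fin n)) :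
    Matrix (Fin d) (Fin d) ℂ :=
  (l.map fun k => (U k : Matrix (Fin d) (Fin d) ℂ)).prod

/-- Move the letter `k` of the word `l` by `a` steps to the right. -/
def shiftRight {n : ℕ} (l : List (Fin n)) (k : Fin n) (a : ℕ) : List (Fin n) :=
  (l.erase k).insertIdx (l.idxOf k + a) k

/-- The word of the identity permutation, `[n-1, …, 1, 0]`. -/
def identityWord (n : ℕ) : List (Fin n) := (List.finRange n).reverse

/-- The word obtained from `[n-1, …, 1, 0]` by moving first `1` by `a 1` steps to the right, then
`2` by `a 2` steps, and so on (the letter `0` comes first, with `a 0 = 0` in all uses). -/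
def factoradicWord {n : ℕ} (a : Fin n → ℕ) : List (Fin n) :=
  (List.finRange n).foldl (fun l k => shiftRight l k (a k)) (identityWord n)

/-- The promise `Π_x = ω ^ (x y) Π_0` for all `0 ≤ x < n!`, where the permutation with the label
`x = ∑ k, a_k k!`, `0 ≤ a_k ≤ k`, is the one of `factoradicWord a`. -/
def FactoradicPromise {n d : ℕ} (U : Fin n → Matrix.unitaryGroup (Fin d) ℂ) (y : ℕ) : Prop :=
  ∀ x < n !, ∀ a : Fin n → ℕ, (∀ k, a k ≤ k) → x = ∑ k, a k * (k : ℕ)! →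
    wordProd U (factoradicWord a) = omega n ^ (x * y) • wordProd U (identityWord n)

/-! ## The circuits -/

/-- The control qubits `c_{k,i}` with `1 ≤ k ≤ n - 1` and `1 ≤ i ≤ ⌈log₂ n⌉`; the qubit `c_{k,i}` is
the pair `(k - 1, i - 1)`. -/
abbrev Ctrl (n : ℕ) : Type := Fin (n - 1) × Fin (Nat.clog 2 n)

/-- The target systems `Ψ_{2^i,j}` with `1 ≤ i ≤ ⌈log₂ n⌉` and `1 ≤ j ≤ 2^i`; the system `Ψ_{2^i,j}`
is the pair `⟨i - 1, j - 1⟩`. -/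
abbrev Target (n : ℕ) : Type := Σ i : Fin (Nat.clog 2 n), Fin (2 ^ ((i : ℕ) + 1))

/-- The auxiliary systems `a_k` with `1 ≤ k ≤ n - 1`; the system `a_k` is `k - 1`. -/
abbrev Aux (n : ℕ) : Type := Fin (n - 1)

/-- The index `k` of the black box that belongs to `c_{k,i}` and to `a_k`. -/
def boxIndex {n : ℕ} (k : Fin (n - 1)) : Fin n := ⟨(k : ℕ) + 1, by omega⟩

/-- The target system that belongs to `c_{k,i}`: it is `Ψ_{2^i,j}` with `j ≡ k` modulo `2^i`. -/
def targetOf {n : ℕ} (q : Ctrl n) : Target n :=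
  ⟨q.2, ⟨(q.1 : ℕ) % 2 ^ ((q.2 : ℕ) + 1), Nat.mod_lt _ (by positivity)⟩⟩

/-- The control qubits in the order `c_{n-1,1}, …, c_{n-1,⌈log₂ n⌉}, …, c_{1,1}, …, c_{1,⌈log₂ n⌉}`
in which the boxes `V_{n-1}, …, V_1` use them. -/
def ctrlOrder (n : ℕ) : List (Ctrl n) :=
  (List.finRange (n - 1)).reverse.flatMap fun k =>
    (List.finRange (Nat.clog 2 n)).map fun i => (k, i)

/-- All target systems. -/
def allTargets (n : ℕ) : List (Target n) :=
  (List.finRange (Nat.clog 2 n)).flatMap fun i : Fin (Nat.clog 2 n) =>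
    (List.finRange (2 ^ ((i : ℕ) + 1))).map fun j => (⟨i, j⟩ : Target n)

/-- The circuit `V_{n-1}, …, V_1`, then `U_0` on every target system, then the mirror image of the
first part: every `U_k` is applied to `Ψ_{2^i, k mod 2^i}` for every `i`, in the first part controlled
on `c_{k,i} = 1` and in the last part controlled on `c_{k,i} = 0`. -/
def circuit (n : ℕ) [NeZero n] : Circuit n (Ctrl n) (Target n) :=
  ((ctrlOrder n).map fun q => .ctrlQuery q true (boxIndex q.1) (targetOf q))
    ++ ((allTargets n).map fun t => .query 0 t)
    ++ ((ctrlOrder n).reverse.map fun q => .ctrlQuery q false (boxIndex q.1) (targetOf q))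

/-- The gates that replace `U_k` on `Ψ_{2^i, k mod 2^i}` controlled on `c_{k,i} = v`: the target
system is exchanged with `a_k` if `c_{k,i} = v`, then `U_k` is applied to `a_k`, and then the
controlled exchange is repeated. -/
def swapGates {n : ℕ} (v : Bool) (q : Ctrl n) : Circuit n (Ctrl n) (Target n ⊕ Aux n) :=
  [.ctrlSwap q v (.inl (targetOf q)) (.inr q.1),
    .query (boxIndex q.1) (.inr q.1),
    .ctrlSwap q v (.inl (targetOf q)) (.inr q.1)]

/-- The circuit `circuit n` with all controlled black boxes replaced by controlled swaps. -/
def swapCircuit (n : ℕ) [NeZero n] : Circuit n (Ctrl n) (Target n ⊕ Aux n) :=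
  ((ctrlOrder n).flatMap (swapGates true))
    ++ ((allTargets n).map fun t => .query 0 (.inl t))
    ++ ((ctrlOrder n).reverse.flatMap (swapGates false))

/-! ## The states in the main transformation -/

/-- The number `∑_{k=1}^{n-1} ∑_{i=1}^{⌈log₂ n⌉} c_{k,i} ⌈k / 2^i⌉ k!` represented by the bits `c`. -/
def bitValue {n : ℕ} (c : Ctrl n → Bool) : ℕ :=
  ∑ k : Fin (n - 1), ∑ i : Fin (Nat.clog 2 n),
    (c (k, i)).toNat * ⌈((k : ℚ) + 1) / 2 ^ ((i : ℕ) + 1)⌉₊ * ((k : ℕ) + 1)!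

/-- The word `[…, 2^i + j, j, 0]` of the indices `k < n` with `k = 0` or `k ≡ j` modulo `2^i`, in
decreasing order, for the target system `Ψ_{2^i,j}`. -/
def targetWord {n : ℕ} [NeZero n] (t : Target n) : List (Fin n) :=
  ((List.finRange n).filter fun k : Fin n =>
    k = 0 ∨ (k : ℕ) ≡ (t.2 : ℕ) + 1 [MOD 2 ^ ((t.1 : ℕ) + 1)]).reverse

/-- The final states `(⋯ U_{2^i+j} U_j U_0) Ψ_{2^i,j}` of the target systems. -/
def targetFinal {n d : ℕ} [NeZero n] (U : Fin n → Matrix.unitaryGroup (Fin d) ℂ)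
    (ψ : Target n → Fin d → ℂ) : Target n → Fin d → ℂ :=
  fun t => wordProd U (targetWord t) *ᵥ ψ t

/-- The final states `(U_k)^⌈log₂ n⌉ a_k` of the auxiliary systems. -/
def auxFinal {n d : ℕ} (U : Fin n → Matrix.unitaryGroup (Fin d) ℂ)
    (a : Aux n → Fin d → ℂ) : Aux n → Fin d → ℂ :=
  fun k => ((U (boxIndex k) : Matrix (Fin d) (Fin d) ℂ) ^ Nat.clog 2 n) *ᵥ a k

/-- The bit strings `enc x` represent the numbers `0 ≤ x < n!`, so that `|x⟩_c` can be taken to be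
the basis vector `|enc x⟩` of the control qubits. -/
def IsEncoding {n : ℕ} (enc : Fin (n !) → Ctrl n → Bool) : Prop :=
  ∀ x, bitValue (enc x) = x

/-- `F` acts as the `n!`-dimensional Fourier transform on the vectors `|x⟩_c = |enc x⟩`:
`F |z⟩_c = (1 / √(n!)) ∑ x, ω ^ (x z) |x⟩_c`. -/
def IsFourier {n : ℕ} (enc : Fin (n !) → Ctrl n → Bool)
    (F : Matrix.unitaryGroup (Ctrl n → Bool) ℂ) : Prop :=
  ∀ z : Fin (n !), (F : Matrix (Ctrl n → Bool) (Ctrl n → Bool) ℂ) *ᵥ Pi.single (enc z) 1 =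
    ((1 / Real.sqrt (n !) : ℝ) : ℂ) •
      ∑ x : Fin (n !), omega n ^ ((x : ℕ) * (z : ℕ)) • Pi.single (enc x) 1

end FPP

end

open FPP

namespace FPP

/-! On a basis vector `c` of the control qubits and a product of system states every gate yields a
product again, so each target system can be followed separately: it just sees a word in the black
boxes. On `Ψ_{2^i,j}` only the boxes `U_k` with `k ≡ j` modulo `2^i` act. Those with `c_{k,i} = 1`
act before `U_0` in decreasing order, the others after `U_0` in increasing order. Read as an
operator product, this is the word "unset boxes decreasing, `0`, set boxes increasing"
(`circuitWord`).

The promise amounts to `U_j U_k = ω^(k! y) U_k U_j` for `j < k` (`factoradicPromise_iff`): a shift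
of `k` crosses only smaller letters, and two shifts of `k` that differ by one step differ by one
adjacent transposition. Since the exponent depends on the larger index only, sorting a circuit word
costs the same for a set letter `k` whatever the other bits are: it crosses `0` and all smaller
letters of its residue class, `⌈k/2^i⌉` letters in all, and contributes `ω^(⌈k/2^i⌉ k! y)`
(`Commutation.wordProd_filter`, `countP_targetBoxes`). The sorted word does not depend on `c`, and
the phases of all targets multiply to `ω^(v(c) y)`.

Every label is some `v(c)`, because each factoradic digit `a ≤ k` is a sum of distinct terms of the
halving sequence `⌈k/2⌉, ⌈k/4⌉, …` (`exists_bits`). The phases `ω^(x y)` turn `F|0⟩` into `F|y⟩`,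
and `F⁻¹` recovers `y`. With swaps in place of control, the box is always called, either on the
target or on `a_k`; over the two halves each `c_{k,i}` sends exactly one call to `a_k`. -/

variable {K S : Type} {n d : ℕ}

/-! ### Gates and gate lists on product vectors -/

theorem productState_smul [Fintype K] [Fintype S] (c : K → Bool) (r : S → ℂ) (ψ : S → Fin d → ℂ) :
    productState c (fun s => r s • ψ s) = (∏ s, r s) • productState c ψ := by
  funext b
  by_cases h : b.1 = c <;> simp [productState, h, Finset.prod_mul_distrib]

theorem onSystem_productState [Fintype K] [Fintype S] [DecidableEq S] (c : K → Bool)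
    (ψ : S → Fin d → ℂ) (s : S) (M : Matrix (Fin d) (Fin d) ℂ) :
    onSystem s M (productState c ψ) = productState c (Function.update ψ s (M *ᵥ ψ s)) := by
  funext b
  by_cases h : b.1 = c
  · simp only [onSystem, productState, LinearMap.coe_mk, AddHom.coe_mk, h, if_true]
    rw [← Finset.mul_prod_erase _ _ (Finset.mem_univ s), Function.update_self, Matrix.mulVec,
      dotProduct, Finset.sum_mul]
    refine Finset.sum_congr rfl fun t _ => ?_
    rw [← Finset.mul_prod_erase _ _ (Finset.mem_univ s), Function.update_self, mul_assoc]
    congr 2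
    refine Finset.prod_congr rfl fun s' hs' => ?_
    rw [Function.update_of_ne (Finset.ne_of_mem_erase hs'),
      Function.update_of_ne (Finset.ne_of_mem_erase hs')]
  · simp [onSystem, productState, h]

theorem swapSystems_productState [Fintype K] [Fintype S] [DecidableEq S] (c : K → Bool)
    (ψ : S → Fin d → ℂ) (s t : S) :
    swapSystems s t (productState c ψ) = productState c (ψ ∘ Equiv.swap s t) := by
  funext b
  by_cases h : b.1 = c
  · simp only [swapSystems, LinearMap.funLeft_apply, productState, h, if_true, Function.comp_apply]
    rw [← Equiv.prod_comp (Equiv.swap s t)]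
    simp
  · simp [swapSystems, LinearMap.funLeft_apply, productState, h]

/-- The control value is fixed on the support of the vector, so the action of `A` on this one vector
decides the result. -/
theorem controlled_productState [Fintype K] [Fintype S] {c : K → Bool} {ψ ψ' : S → Fin d → ℂ}
    {A : State K S d →ₗ[ℂ] State K S d} (hA : A (productState c ψ) = productState c ψ')
    (q : K) (v : Bool) :
    controlled q v A (productState c ψ) = productState c (if c q = v then ψ' else ψ) := by
  funext b
  simp only [controlled, LinearMap.coe_mk, AddHom.coe_mk, hA]
  by_cases h : b.1 = c
  · subst h; split_ifs <;> rfl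
  · simp [productState, h]

theorem Circuit.op_append [DecidableEq S] (U : Fin n → Matrix.unitaryGroup (Fin d) ℂ)
    (A B : Circuit n K S) (f : State K S d) :
    Circuit.op U (A ++ B) f = Circuit.op U B (Circuit.op U A f) := by
  induction A generalizing f with
  | nil => rfl
  | cons g A ih => exact ih _

@[simp] theorem wordProd_nil (U : Fin n → Matrix.unitaryGroup (Fin d) ℂ) : wordProd U [] = 1 := rfl

@[simp] theorem wordProd_cons (U : Fin n → Matrix.unitaryGroup (Fin d) ℂ) (k : Fin n)
    (l : List (Fin n)) : wordProd U (k :: l) = (U k : Matrix (Fin d) (Fin d) ℂ) * wordProd U l := by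
  simp [wordProd]

@[simp] theorem wordProd_append (U : Fin n → Matrix.unitaryGroup (Fin d) ℂ)
    (l l' : List (Fin n)) : wordProd U (l ++ l') = wordProd U l * wordProd U l' := by
  simp [wordProd]

theorem isUnit_wordProd (U : Fin n → Matrix.unitaryGroup (Fin d) ℂ) (l : List (Fin n)) :
    IsUnit (wordProd U l) := by
  induction l with
  | nil => exact isUnit_one
  | cons k l ih =>
    rw [wordProd_cons]
    exact (Unitary.toUnits (U k)).isUnit.mul ih

/-- The action of a list of controlled black boxes on a product vector. -/
theorem op_map_ctrlQuery (U : Fin n → Matrix.unitaryGroup (Fin d) ℂ) (v : Bool)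
    (c : Ctrl n → Bool) (L : List (Ctrl n)) (ψ : Target n → Fin d → ℂ) :
    Circuit.op U (L.map fun q => .ctrlQuery q v (boxIndex q.1) (targetOf q)) (productState c ψ) =
      productState c fun t => wordProd U
        ((L.filter fun q => targetOf q = t ∧ c q = v).map fun q => boxIndex q.1).reverse *ᵥ ψ t := by
  induction L generalizing ψ with
  | nil => simp [Circuit.op]
  | cons q L ih =>
    simp only [List.map_cons, Circuit.op, LinearMap.comp_apply, Gate.op]
    rw [controlled_productState (onSystem_productState _ _ _ _), ih]
    congr 1
    funext t
    by_cases hv : c q = v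
    · by_cases ht : targetOf q = t
      · subst ht
        -- Later gates multiply from the left, hence the reversed list.
        simp [hv, Matrix.mulVec_mulVec]
      · simp [hv, ht, Ne.symm ht]
    · simp [hv]

/-- If the swaps fire, the target takes the place of `a_k` during the query and returns; otherwise
the query falls on `a_k` itself. -/
theorem op_swapGates (U : Fin n → Matrix.unitaryGroup (Fin d) ℂ) (v : Bool)
    (c : Ctrl n → Bool) (q : Ctrl n) (ψ : Target n → Fin d → ℂ) (a : Aux n → Fin d → ℂ) :
    Circuit.op U (swapGates v q) (productState c (Sum.elim ψ a)) =
      productState c (if c q = v then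
          Sum.elim (Function.update ψ (targetOf q)
            ((U (boxIndex q.1) : Matrix (Fin d) (Fin d) ℂ) *ᵥ ψ (targetOf q))) a
        else Sum.elim ψ (Function.update a q.1
            ((U (boxIndex q.1) : Matrix (Fin d) (Fin d) ℂ) *ᵥ a q.1))) := by
  simp only [swapGates, Circuit.op, LinearMap.comp_apply, Gate.op, LinearMap.id_apply]
  rw [controlled_productState (swapSystems_productState _ _ _ _), onSystem_productState,
    controlled_productState (swapSystems_productState _ _ _ _)]
  congr 1
  by_cases hv : c q = v
  · simp only [hv, if_true]
    funext s
    rcases s with t | k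
    · by_cases ht : t = targetOf q
      · subst ht; simp
      · simp [ht, Equiv.swap_apply_of_ne_of_ne, Function.update_of_ne]
    · by_cases hk : k = q.1
      · subst hk; simp
      · simp [hk, Equiv.swap_apply_of_ne_of_ne, Function.update_of_ne]
  · simp only [if_neg hv, Sum.elim_inr, Sum.update_elim_inr]

/-- The action of a list of controlled swaps on a product vector. -/
theorem op_flatMap_swapGates (U : Fin n → Matrix.unitaryGroup (Fin d) ℂ) (v : Bool)
    (c : Ctrl n → Bool) (L : List (Ctrl n)) (ψ : Target n → Fin d → ℂ) (a : Aux n → Fin d → ℂ) :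
    Circuit.op U (L.flatMap (swapGates v)) (productState c (Sum.elim ψ a)) =
      productState c (Sum.elim (fun t => wordProd U
        ((L.filter fun q => targetOf q = t ∧ c q = v).map fun q => boxIndex q.1).reverse *ᵥ ψ t)
        fun k => ((U (boxIndex k) : Matrix (Fin d) (Fin d) ℂ) ^
          L.countP fun q => q.1 = k ∧ c q ≠ v) *ᵥ a k) := by
  induction L generalizing ψ a with
  | nil => simp [Circuit.op]
  | cons q L ih =>
    rw [List.flatMap_cons, Circuit.op_append, op_swapGates]
    by_cases hv : c q = v
    · rw [if_pos hv, ih]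
      congr 2
      · funext t
        by_cases ht : targetOf q = t
        · subst ht
          simp [hv, Matrix.mulVec_mulVec]
        · simp [hv, ht, Ne.symm ht]
      · funext k
        simp [hv]
    · rw [if_neg hv, ih]
      congr 2
      · funext t
        simp [hv]
      · funext k
        by_cases hk : q.1 = k
        · subst hk
          simp [hv, Matrix.mulVec_mulVec, pow_succ]
        · simp [hk, Ne.symm hk]

/-- The action of a list of black boxes on distinct systems. -/
theorem op_map_query [Fintype K] [Fintype S] [DecidableEq S]
    (U : Fin n → Matrix.unitaryGroup (Fin d) ℂ) (m : Fin n) (c : K → Bool) (L : List S)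
    (hL : L.Nodup) (ψ : S → Fin d → ℂ) :
    Circuit.op U (L.map fun s => (.query m s : Gate n K S)) (productState c ψ) =
      productState c fun s => if s ∈ L then (U m : Matrix (Fin d) (Fin d) ℂ) *ᵥ ψ s else ψ s := by
  induction L generalizing ψ with
  | nil => simp [Circuit.op]
  | cons q L ih =>
    simp only [List.map_cons, Circuit.op, LinearMap.comp_apply, Gate.op]
    rw [onSystem_productState, ih hL.of_cons]
    congr 1
    funext s
    by_cases hs : s = q
    · subst hs
      simp [(List.nodup_cons.mp hL).1]
    · simp [hs, Function.update_of_ne]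

theorem mem_allTargets (t : Target n) : t ∈ allTargets n := by
  obtain ⟨i, j⟩ := t
  simp [allTargets]

theorem nodup_allTargets : (allTargets n).Nodup := by
  refine List.nodup_flatMap.mpr ⟨fun i _ => (List.nodup_finRange _).map fun a b h => by simpa using h,
    (List.nodup_finRange _).pairwise_of_forall_ne fun i _ i' _ h => ?_⟩
  simp only [Function.onFun, List.disjoint_left, List.mem_map, not_exists]
  rintro _ ⟨j, _, rfl⟩ j' ⟨_, h'⟩
  exact h (congrArg Sigma.fst h').symm

theorem onQubits_mul [Fintype K] [DecidableEq K] (F G : Matrix (K → Bool) (K → Bool) ℂ)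
    (f : State K S d) : onQubits F (onQubits G f) = onQubits (F * G) f := by
  funext b
  simp only [onQubits, LinearMap.coe_mk, AddHom.coe_mk, Finset.mul_sum, Matrix.mul_apply,
    Finset.sum_mul]
  rw [Finset.sum_comm]
  exact Finset.sum_congr rfl fun _ _ => Finset.sum_congr rfl fun _ _ => (mul_assoc _ _ _).symm

theorem onQubits_one [Fintype K] [DecidableEq K] (f : State K S d) :
    onQubits (1 : Matrix (K → Bool) (K → Bool) ℂ) f = f := by
  funext b
  simp [onQubits, Matrix.one_apply]

theorem onQubits_productState [Fintype K] [DecidableEq K] [Fintype S]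
    (F : Matrix (K → Bool) (K → Bool) ℂ) (c : K → Bool) (ψ : S → Fin d → ℂ) {ι : Type*}
    [Fintype ι] (r : ι → ℂ) (e : ι → K → Bool)
    (hF : F *ᵥ Pi.single c 1 = ∑ x, r x • Pi.single (e x) 1) :
    onQubits F (productState c ψ) = ∑ x, r x • productState (e x) ψ := by
  funext b
  have h := congrFun hF b.1
  simp only [Matrix.mulVec_single_one, Matrix.col_apply, Finset.sum_apply, Pi.smul_apply,
    Pi.single_apply, smul_eq_mul] at h
  simp [onQubits, productState, h, Finset.sum_mul]

/-! ### The promise and the commutation relations -/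

/-- The commutation relations `U_j U_k = ω ^ (k! y) U_k U_j` for `j < k`. -/
def Commutation (U : Fin n → Matrix.unitaryGroup (Fin d) ℂ) (y : ℕ) : Prop :=
  ∀ j k : Fin n, j < k → (U j * U k : Matrix (Fin d) (Fin d) ℂ) =
    omega n ^ ((k : ℕ)! * y) • (U k * U j : Matrix (Fin d) (Fin d) ℂ)

/-- The phase of an exchange depends on the larger index only, so just the number of crossed letters
counts. -/
theorem Commutation.wordProd_mul {U : Fin n → Matrix.unitaryGroup (Fin d) ℂ} {y : ℕ}
    (h : Commutation U y) (k : Fin n) (l : List (Fin n)) (hl : ∀ j ∈ l, j < k) :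
    wordProd U l * (U k : Matrix (Fin d) (Fin d) ℂ) =
      omega n ^ (l.length * (k : ℕ)! * y) • ((U k : Matrix (Fin d) (Fin d) ℂ) * wordProd U l) := by
  induction l with
  | nil => simp
  | cons j l ih =>
    rw [wordProd_cons, mul_assoc, ih fun i hi => hl i (List.mem_cons_of_mem _ hi), mul_smul_comm,
      ← mul_assoc, h j k (hl j List.mem_cons_self), smul_mul_assoc, smul_smul, ← pow_add,
      mul_assoc (U k : Matrix (Fin d) (Fin d) ℂ), List.length_cons]
    congr 2
    ring

theorem insertIdx_eq_take_append_drop {α : Type*} (l : List α) (m : ℕ) (hm : m ≤ l.length) (x : α) :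
    l.insertIdx m x = l.take m ++ x :: l.drop m := by
  induction l generalizing m with
  | nil => obtain rfl : m = 0 := by simpa using hm
           simp
  | cons b l ih =>
    cases m with
    | zero => simp
    | succ m => simp [ih m (by simpa using hm)]

theorem shiftRight_append_cons (p l : List (Fin n)) (k : Fin n) (m : ℕ) (hk : k ∉ p)
    (hm : m ≤ l.length) :
    shiftRight (p ++ k :: l) k m = p ++ l.take m ++ k :: l.drop m := by
  have h1 : (p ++ k :: l).erase k = p ++ l := by
    rw [List.erase_append_right _ hk, List.erase_cons_head]
  have h2 : (p ++ k :: l).idxOf k = p.length := by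
    rw [List.idxOf_append_of_notMem hk]; simp
  rw [shiftRight, h1, h2, insertIdx_eq_take_append_drop _ _ (by simpa using hm)]
  simp [List.take_append, List.drop_append, List.take_of_length_le, List.drop_eq_nil_of_le]

theorem shiftRight_zero (l : List (Fin n)) (k : Fin n) (hk : k ∈ l) : shiftRight l k 0 = l := by
  obtain ⟨p, s, rfl, h⟩ := List.eq_append_cons_of_mem hk
  simp [shiftRight_append_cons p s k 0 h (Nat.zero_le _)]

theorem foldl_shiftRight_zero (a : Fin n → ℕ) (L l : List (Fin n)) (hL : ∀ k ∈ L, k ∈ l)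
    (ha : ∀ k ∈ L, a k = 0) : L.foldl (fun l k => shiftRight l k (a k)) l = l := by
  induction L with
  | nil => rfl
  | cons k L ih =>
    rw [List.foldl_cons, ha k List.mem_cons_self, shiftRight_zero l k (hL k List.mem_cons_self)]
    exact ih (fun j hj => hL j (List.mem_cons_of_mem _ hj)) fun j hj => ha j (List.mem_cons_of_mem _ hj)

/-- Invariant of the successive shifts: `L` holds the consecutive letters still to be moved, and `w`
is the already rearranged word of smaller letters. When `k` is moved, `k = w.length`, so `a k ≤ k`
keeps it within `w` and it crosses exactly `a k` smaller letters. -/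
theorem Commutation.wordProd_foldl {U : Fin n → Matrix.unitaryGroup (Fin d) ℂ} {y : ℕ}
    (h : Commutation U y) (a : Fin n → ℕ) (ha : ∀ k, a k ≤ k) (L w : List (Fin n))
    (hL : L.map Fin.val = List.range' w.length L.length) (hw : ∀ j ∈ w, (j : ℕ) < w.length) :
    wordProd U (L.foldl (fun l k => shiftRight l k (a k)) (L.reverse ++ w)) =
      omega n ^ ((L.map fun k => a k * (k : ℕ)!).sum * y) • wordProd U (L.reverse ++ w) := by
  induction L generalizing w with
  | nil => simp
  | cons k L ih =>
    rw [List.map_cons, List.length_cons, List.range'_succ, List.cons.injEq] at hL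
    obtain ⟨hk, hL⟩ := hL
    have hkL : k ∉ L.reverse := fun hmem => by
      have : (k : ℕ) ∈ L.map Fin.val := List.mem_map_of_mem (List.mem_reverse.mp hmem)
      rw [hL, List.mem_range'_1] at this
      omega
    have hak : a k ≤ w.length := hk ▸ ha k
    rw [List.foldl_cons, List.reverse_cons, List.append_assoc, List.singleton_append,
      shiftRight_append_cons _ _ _ _ hkL hak, List.append_assoc, ih]
    -- The shifted word contains `U_k` behind the first `a k` letters of `w`; pulling it back in
    -- front of them yields the phase.
    · have hcomm := h.wordProd_mul k (w.take (a k)) fun j hj =>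
        Fin.lt_def.mpr (hk ▸ hw j (List.mem_of_mem_take hj))
      have hw' : wordProd U w = wordProd U (w.take (a k)) * wordProd U (w.drop (a k)) := by
        rw [← wordProd_append, List.take_append_drop]
      simp only [wordProd_append, wordProd_cons, List.map_cons, List.sum_cons, hw']
      rw [← mul_assoc (wordProd U (w.take (a k))), hcomm, List.length_take, min_eq_left hak,
        smul_mul_assoc, mul_smul_comm, smul_smul, ← pow_add,
        mul_assoc (U k : Matrix (Fin d) (Fin d) ℂ)]
      congr 2
      ring
    · rw [hL]
      congr 1
      simp
      omega
    · intro j hj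
      have hlen : (w.take (a k) ++ k :: w.drop (a k)).length = w.length + 1 := by
        simp
        omega
      rw [hlen]
      rcases List.mem_append.mp hj with hj | hj
      · exact (hw j (List.mem_of_mem_take hj)).trans (Nat.lt_succ_self _)
      · rcases List.mem_cons.mp hj with rfl | hj
        · omega
        · exact (hw j (List.mem_of_mem_drop hj)).trans (Nat.lt_succ_self _)

theorem Commutation.factoradicPromise {U : Fin n → Matrix.unitaryGroup (Fin d) ℂ} {y : ℕ}
    (h : Commutation U y) : FactoradicPromise U y := by
  rintro x - a ha rfl
  have := h.wordProd_foldl a ha (List.finRange n) [] (by simp [List.range_eq_range']) (by simp)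
  rw [List.append_nil] at this
  rw [factoradicWord, identityWord, this, Fin.sum_univ_def]

/-- Shifts by zero steps are idle, so only the move of `k` matters: the larger letters stay in front
of it and it enters the decreasing word of the smaller ones. -/
theorem factoradicWord_single (k : Fin n) (m : ℕ) (hm : m ≤ k) :
    factoradicWord (Pi.single k m) =
      ((List.finRange n).drop (k + 1)).reverse ++ ((List.finRange n).take k).reverse.take m ++
        k :: ((List.finRange n).take k).reverse.drop m := by
  have hsplit : List.finRange n = (List.finRange n).take k ++ k :: (List.finRange n).drop (k + 1) := by
    have := (List.take_append_drop (k : ℕ) (List.finRange n)).symm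
    rw [List.drop_eq_getElem_cons (by simp)] at this
    simpa using this
  set A := (List.finRange n).take k
  set B := (List.finRange n).drop (k + 1)
  have hnd := List.nodup_finRange n
  rw [hsplit] at hnd
  have hkA : k ∉ A := fun hk => (List.disjoint_of_nodup_append hnd) hk List.mem_cons_self
  have hkB : k ∉ B := (List.nodup_cons.mp hnd.of_append_right).1
  have hlen : A.length = k := by simp [A]
  rw [factoradicWord, identityWord, hsplit, List.foldl_append, foldl_shiftRight_zero _ A,
    List.foldl_cons, Pi.single_eq_same, List.reverse_append, List.reverse_cons, List.append_assoc,
    List.singleton_append, shiftRight_append_cons _ _ _ _ (by simpa using hkB)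
      (by simpa [hlen] using hm), foldl_shiftRight_zero]
  · intro j hj; simp [hj]
  · intro j hj; exact Pi.single_eq_of_ne (by rintro rfl; exact hkB hj) _
  · intro j hj; simp [hj]
  · intro j hj; exact Pi.single_eq_of_ne (by rintro rfl; exact hkA hj) _

theorem FactoradicPromise.single {U : Fin n → Matrix.unitaryGroup (Fin d) ℂ} {y : ℕ}
    (h : FactoradicPromise U y) (k : Fin n) (m : ℕ) (hm : m ≤ k) :
    wordProd U (factoradicWord (Pi.single k m)) =
      omega n ^ (m * (k : ℕ)! * y) • wordProd U (identityWord n) := by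
  refine h (m * (k : ℕ)!) ?_ (Pi.single k m) (fun i => ?_) ?_
  · calc m * (k : ℕ)! ≤ k * (k : ℕ)! := Nat.mul_le_mul_right _ hm
      _ < ((k : ℕ) + 1)! := by
        rw [Nat.factorial_succ]
        exact Nat.mul_lt_mul_of_pos_right (Nat.lt_succ_self _) (Nat.factorial_pos _)
      _ ≤ n ! := Nat.factorial_le k.2
  · by_cases hi : i = k
    · subst hi; simpa using hm
    · simp [hi]
  · rw [Finset.sum_eq_single k] <;> simp +contextual

/-- Moving `k` to just before `j` and to just behind `j` gives words that differ only in `k j`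
versus `j k`, while the promised phases differ by the factor `ω^(k! y)`. The common outer factors
are invertible and cancel. -/
theorem FactoradicPromise.commutation {U : Fin n → Matrix.unitaryGroup (Fin d) ℂ} {y : ℕ}
    (h : FactoradicPromise U y) : Commutation U y := by
  intro j k hjk
  have hj : j ∈ ((List.finRange n).take k).reverse := by
    rw [List.mem_reverse, List.mem_take_iff_getElem]
    exact ⟨j, by simpa using hjk, by simp⟩
  -- `A` consists of the letters between `k` and `j`; the two shifts have lengths `|A|` and `|A| +
  -- 1`.
  obtain ⟨A, B, hAB⟩ := List.append_of_mem hj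
  have hlen : A.length + 1 ≤ k := by
    have := congrArg List.length hAB
    simp at this
    omega
  have h0 := h.single k A.length (by omega)
  have h1 := h.single k (A.length + 1) hlen
  rw [factoradicWord_single _ _ (by omega), hAB] at h0 h1
  simp only [List.take_left, List.drop_left, List.take_length_add_append,
    List.drop_length_add_append, List.take_succ_cons, List.take_zero, List.drop_succ_cons,
    List.drop_zero, wordProd_append, wordProd_cons, wordProd_nil, mul_one] at h0 h1
  have key : wordProd U ((List.finRange n).drop (k + 1)).reverse * wordProd U A *
      ((U j * U k : Matrix (Fin d) (Fin d) ℂ) * wordProd U B) =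
      wordProd U ((List.finRange n).drop (k + 1)).reverse * wordProd U A *
      ((omega n ^ ((k : ℕ)! * y) • (U k * U j : Matrix (Fin d) (Fin d) ℂ)) * wordProd U B) := by
    rw [smul_mul_assoc, mul_smul_comm]
    simp only [mul_assoc] at h0 h1 ⊢
    rw [h0, h1, smul_smul, ← pow_add]
    congr 2
    ring
  exact (isUnit_wordProd U B).mul_right_cancel
    (((isUnit_wordProd U _).mul (isUnit_wordProd U A)).mul_left_cancel key)

theorem factoradicPromise_iff {U : Fin n → Matrix.unitaryGroup (Fin d) ℂ} {y : ℕ} :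
    FactoradicPromise U y ↔ Commutation U y :=
  ⟨FactoradicPromise.commutation, Commutation.factoradicPromise⟩

/-! ### Sorting the word seen by one target system -/

/-- Moving the letters that satisfy `p` from the right end of a word to their place in the
decreasing order. -/
theorem Commutation.wordProd_filter {U : Fin n → Matrix.unitaryGroup (Fin d) ℂ} {y : ℕ}
    (h : Commutation U y) (z : Fin n) {α : Type*} (f : α → Fin n) (p : α → Bool) (L : List α)
    (hL : L.Pairwise (f · < f ·)) (hz : ∀ k ∈ L, z < f k) :
    wordProd U (((L.filter fun k => !p k).map f).reverse ++ z :: (L.filter p).map f) =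
      omega n ^ ((L.map fun k =>
          (p k).toNat * (L.countP (fun j => f j < f k) + 1) * (f k : ℕ)!).sum * y) •
        wordProd U ((L.map f).reverse ++ [z]) := by
  -- The induction removes the largest letter: it stands at the far left if unset and at the far
  -- right if set, so the rest is a word of the same form.
  induction L using List.reverseRecOn with
  | nil => simp
  | append_singleton L k ih =>
    have hlt : ∀ j ∈ L, f j < f k := fun j hj =>
      (List.pairwise_append.mp hL).2.2 j hj k List.mem_cons_self
    have ih := ih (List.pairwise_append.mp hL).1 fun j hj => hz j (by simp [hj])
    have hcount : (L ++ [k]).countP (fun j => f j < f k) = L.length := by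
      rw [List.countP_append, List.countP_eq_length.mpr (by simpa using hlt)]
      simp
    -- The new letter exceeds all others and leaves their counts unchanged.
    have hmap : (L.map fun j =>
          (p j).toNat * ((L ++ [k]).countP (fun i => f i < f j) + 1) * (f j : ℕ)!) =
        L.map fun j => (p j).toNat * (L.countP (fun i => f i < f j) + 1) * (f j : ℕ)! := by
      refine List.map_congr_left fun j hj => ?_
      simp [List.countP_append, (hlt j hj).le]
    rw [List.map_append, hmap, List.sum_append, List.map_singleton, List.sum_singleton, hcount]
    cases hp : p k with
    | false =>
      simp only [List.filter_append, List.filter_singleton, hp, List.map_append, List.map_singleton,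
        Bool.not_false, cond_true, cond_false, List.append_nil, List.reverse_append,
        List.reverse_singleton, List.cons_append, Bool.toNat_false, zero_mul,
        add_zero, List.nil_append] at ih ⊢
      rw [wordProd_cons, ih, mul_smul_comm, wordProd_cons]
    | true =>
      -- After the shorter word is sorted, the set letter `f k` crosses all of it, `z` included:
      -- `L.length + 1` letters.
      have hcomm := h.wordProd_mul (f k) ((L.map f).reverse ++ [z]) (by
        intro j hj
        rcases List.mem_append.mp hj with hj | hj
        · obtain ⟨i, hi, rfl⟩ := List.mem_map.mp (List.mem_reverse.mp hj)
          exact hlt i hi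
        · rw [List.mem_singleton.mp hj]
          exact hz k (by simp))
      have hone : wordProd U [f k] = U (f k) := by simp
      have e1 : (L ++ [k]).filter (fun k => !p k) = L.filter (fun k => !p k) := by simp [hp]
      have e2 : (L ++ [k]).filter p = L.filter p ++ [k] := by simp [hp]
      rw [e1, e2, List.map_append, ← List.cons_append, ← List.append_assoc, wordProd_append, ih,
        List.map_append, List.reverse_append, List.append_assoc,
        smul_mul_assoc, List.map_singleton, List.reverse_singleton,
        hone, hcomm, smul_smul, ← pow_add, wordProd_append U [f k], hone]
      congr 2
      simp
      ring

/-! ### Representing labels by control bits -/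

/-- Division by the largest factorial gives the leading digit, and the remainder gives the others.
The position `k` carries `(k + 1)!`, in line with the index shift of the control qubits. -/
theorem exists_factoradic (m x : ℕ) (hx : x < (m + 1)!) :
    ∃ a : ℕ → ℕ, (∀ k, a k ≤ k + 1) ∧ x = ∑ k : Fin m, a k * ((k : ℕ) + 1)! := by
  induction m generalizing x with
  | zero => exact ⟨0, by simp, by simpa using hx⟩
  | succ m ih =>
    obtain ⟨a, ha, hsum⟩ := ih (x % (m + 1)!) (Nat.mod_lt _ (Nat.factorial_pos _))
    refine ⟨Function.update a m (x / (m + 1)!), fun k => ?_, ?_⟩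
    · by_cases hk : k = m
      · subst hk
        rw [Function.update_self]
        refine Nat.lt_succ_iff.mp (Nat.div_lt_of_lt_mul ?_)
        rw [mul_comm, ← Nat.factorial_succ]
        exact hx
      · rw [Function.update_of_ne hk]
        exact ha k
    · rw [Fin.sum_univ_castSucc]
      have : ∀ k : Fin m, Function.update a m (x / (m + 1)!) (k : ℕ) = a k :=
        fun k => Function.update_of_ne k.2.ne _ _
      simp only [this, Fin.val_castSucc, ← hsum, Fin.val_last, Function.update_self]
      rw [mul_comm, Nat.mod_add_div]

/-- Greedy choice, with `κ = k - 1` and so `κ / 2^i + 1 = ⌈k/2^i⌉`. Subtracting `⌈k/2⌉` from `a`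
whenever possible leaves at most `⌈k/2⌉`, and the remaining terms are those of `κ / 2`. The bound `a
< 2 ^ m` makes the remainder zero when no term is left; `a ≤ κ + 1` alone would allow `1` there. -/
theorem exists_bits (m κ a : ℕ) (hκ : κ < 2 ^ m) (ha : a ≤ κ + 1) (ham : a < 2 ^ m) :
    ∃ b : Fin m → Bool, a = ∑ i, (b i).toNat * (κ / 2 ^ ((i : ℕ) + 1) + 1) := by
  induction m generalizing κ a with
  | zero => exact ⟨fun _ => false, by simpa using ham⟩
  | succ m ih =>
    rw [pow_succ] at hκ ham
    have hdiv : ∀ i : Fin m, κ / 2 ^ ((i.succ : ℕ) + 1) = κ / 2 / 2 ^ ((i : ℕ) + 1) := fun i => by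
      rw [Nat.div_div_eq_div_mul, ← pow_succ', Fin.val_succ]
    by_cases h : κ / 2 + 1 ≤ a
    · obtain ⟨b, hb⟩ := ih (κ / 2) (a - (κ / 2 + 1)) (by omega) (by omega) (by omega)
      refine ⟨Fin.cons true b, ?_⟩
      rw [Fin.sum_univ_succ]
      simp only [Fin.cons_zero, Fin.cons_succ, hdiv, ← hb]
      simp
      omega
    · obtain ⟨b, hb⟩ := ih (κ / 2) a (by omega) (by omega) (by omega)
      refine ⟨Fin.cons false b, ?_⟩
      rw [Fin.sum_univ_succ]
      simp only [Fin.cons_zero, Fin.cons_succ, hdiv, ← hb]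
      simp

theorem ceil_succ_div (k r : ℕ) (hr : 0 < r) : ⌈((k : ℚ) + 1) / r⌉₊ = k / r + 1 := by
  have hr' : (0 : ℚ) < r := by exact_mod_cast hr
  rw [Nat.ceil_eq_iff (Nat.succ_ne_zero _)]
  have h1 := Nat.div_add_mod k r
  have h2 := Nat.mod_lt k hr
  constructor
  · rw [Nat.succ_sub_one, lt_div_iff₀ hr']
    have : k / r * r < k + 1 := by rw [mul_comm]; omega
    exact_mod_cast this
  · rw [div_le_iff₀ hr']
    have : k + 1 ≤ (k / r + 1) * r := by rw [add_mul, mul_comm]; omega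
    exact_mod_cast this

theorem bitValue_eq (c : Ctrl n → Bool) :
    bitValue c = ∑ k : Fin (n - 1), ∑ i : Fin (Nat.clog 2 n),
      (c (k, i)).toNat * ((k : ℕ) / 2 ^ ((i : ℕ) + 1) + 1) * ((k : ℕ) + 1)! := by
  refine Finset.sum_congr rfl fun k _ => Finset.sum_congr rfl fun i _ => ?_
  rw [← ceil_succ_div _ _ (by positivity)]
  push_cast
  rfl

theorem exists_bitValue_eq [NeZero n] (x : ℕ) (hx : x < n !) :
    ∃ c : Ctrl n → Bool, bitValue c = x := by
  have hn : n - 1 + 1 = n := Nat.sub_add_cancel (NeZero.pos n)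
  obtain ⟨a, ha, rfl⟩ := exists_factoradic (n - 1) x (by rwa [hn])
  -- Since `k + 1 < n ≤ 2 ^ ⌈log₂ n⌉`, there are enough halvings for every digit.
  have hpow := Nat.le_pow_clog one_lt_two n
  have hbits : ∀ k : Fin (n - 1), ∃ b : Fin (Nat.clog 2 n) → Bool,
      a k = ∑ i, (b i).toNat * ((k : ℕ) / 2 ^ ((i : ℕ) + 1) + 1) := fun k => by
    have := ha k
    exact exists_bits _ _ _ (by omega) this (by omega)
  choose b hb using hbits
  refine ⟨fun q => b q.1 q.2, ?_⟩
  rw [bitValue_eq]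
  exact Finset.sum_congr rfl fun k _ => by rw [hb, Finset.sum_mul]

/-! ### Query counts and register sizes -/

theorem clog_lt_logb_add_one [NeZero n] : (Nat.clog 2 n : ℝ) < Real.logb 2 n + 1 := by
  have h := Real.natCeil_logb_natCast 2 n
  rw [← h]
  exact Nat.ceil_lt_add_one (Real.logb_nonneg one_lt_two (by exact_mod_cast NeZero.one_le))

theorem two_pow_clog_lt [NeZero n] : 2 ^ Nat.clog 2 n < 2 * n := by
  rcases Nat.lt_or_ge 1 n with h | h
  · have h1 := Nat.pow_pred_clog_lt_self one_lt_two h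
    have h2 := Nat.clog_pos one_lt_two h
    obtain ⟨m, hm⟩ := Nat.exists_eq_succ_of_ne_zero h2.ne'
    rw [hm] at h1 ⊢
    rw [pow_succ]
    simp at h1
    omega
  -- The case `n = 1` is separate, as `2 ^ (⌈log₂ n⌉ - 1) < n` fails there with truncated
  -- subtraction.
  · have := NeZero.pos n
    rw [Nat.clog_of_right_le_one h]
    omega

theorem queries_lt [NeZero n] :
    ((2 * (n - 1) * Nat.clog 2 n + 2 ^ (Nat.clog 2 n + 1) - 2 : ℕ) : ℝ) <
      2 * ((n : ℝ) - 1) * (Real.logb 2 n + 1) + 4 * n - 2 := by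
  have h1 := clog_lt_logb_add_one (n := n)
  have h2 : ((2 ^ Nat.clog 2 n : ℕ) : ℝ) < ((2 * n : ℕ) : ℝ) := by exact_mod_cast two_pow_clog_lt
  have h3 : (1 : ℝ) ≤ n := by exact_mod_cast NeZero.one_le
  have h4 : 1 ≤ 2 ^ Nat.clog 2 n := Nat.one_le_two_pow
  rw [Nat.cast_sub (by rw [pow_succ]; omega), pow_succ]
  push_cast [NeZero.one_le] at h2 ⊢
  nlinarith [mul_le_mul_of_nonneg_left h1.le (sub_nonneg.mpr h3)]

theorem queries_le [NeZero n] :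
    ((2 * (n - 1) * Nat.clog 2 n + 2 ^ (Nat.clog 2 n + 1) - 2 : ℕ) : ℝ) ≤
      8 * (n * Real.logb 2 n) := by
  rcases Nat.lt_or_ge 1 n with h | h
  · have h1 := queries_lt (n := n)
    have h2 : (2 : ℝ) ≤ n := by exact_mod_cast h
    have h3 : 1 ≤ Real.logb 2 n := by
      rw [Real.le_logb_iff_rpow_le one_lt_two (by linarith)]
      simpa using h2
    -- The bound is at most `2 n log₂ n + 6 n`, and `log₂ n ≥ 1` absorbs the linear term: this gives
    -- the constant `8`.
    nlinarith [mul_le_mul_of_nonneg_left h3 (by linarith : (0 : ℝ) ≤ n)]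
  -- Both sides vanish: there are no target systems and no control qubits.
  · obtain rfl : n = 1 := le_antisymm h NeZero.one_le
    simp

theorem card_ctrl : Fintype.card (Ctrl n) = (n - 1) * Nat.clog 2 n := by
  simp

theorem card_target : Fintype.card (Target n) = 2 ^ (Nat.clog 2 n + 1) - 2 := by
  rw [Fintype.card_sigma]
  simp only [Fintype.card_fin]
  induction Nat.clog 2 n with
  | zero => simp
  | succ m ih =>
    rw [Fin.sum_univ_castSucc]
    simp only [Fin.val_castSucc, Fin.val_last, ih]
    have : 1 ≤ 2 ^ m := Nat.one_le_two_pow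
    simp only [pow_succ]
    omega

theorem length_ctrlOrder : (ctrlOrder n).length = (n - 1) * Nat.clog 2 n := by
  simp [ctrlOrder, List.length_flatMap]

theorem length_allTargets : (allTargets n).length = 2 ^ (Nat.clog 2 n + 1) - 2 := by
  rw [← card_target, ← List.toFinset_card_of_nodup nodup_allTargets, ← Finset.card_univ]
  congr 1
  ext t
  simp [mem_allTargets]

theorem circuit_queries [NeZero n] : (circuit n).queries =
    2 * (n - 1) * Nat.clog 2 n + 2 ^ (Nat.clog 2 n + 1) - 2 := by
  have : 1 ≤ 2 ^ Nat.clog 2 n := Nat.one_le_two_pow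
  simp only [Circuit.queries, circuit, List.map_append, List.map_map, List.sum_append,
    Function.comp_def, Gate.queries, List.map_const', List.sum_replicate, List.length_reverse,
    length_ctrlOrder, length_allTargets, smul_eq_mul, mul_one, mul_assoc, pow_succ]
  omega

theorem swapCircuit_queries [NeZero n] : (swapCircuit n).queries =
    2 * (n - 1) * Nat.clog 2 n + 2 ^ (Nat.clog 2 n + 1) - 2 := by
  have : 1 ≤ 2 ^ Nat.clog 2 n := Nat.one_le_two_pow
  have hflat : ∀ (v : Bool) (L : List (Ctrl n)),
      ((L.flatMap (swapGates v)).map Gate.queries).sum = L.length := fun v L => by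
    induction L with
    | nil => rfl
    | cons q L ih => simp [ih, swapGates, Gate.queries, add_comm]
  simp only [Circuit.queries, swapCircuit, List.map_append, hflat, List.map_map, List.sum_append,
    Function.comp_def, Gate.queries, List.map_const', List.sum_replicate, List.length_reverse,
    length_ctrlOrder, length_allTargets, smul_eq_mul, mul_one, mul_assoc, pow_succ]
  omega

theorem not_controlsUnknown_of_mem_swapCircuit [NeZero n] :
    ∀ g ∈ swapCircuit n, ¬ g.ControlsUnknown := by
  intro g hg
  simp only [swapCircuit, swapGates, List.mem_append, List.mem_flatMap, List.mem_map,
    List.mem_cons, List.not_mem_nil, or_false] at hg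
  rcases hg with (⟨q, -, rfl | rfl | rfl⟩ | ⟨t, -, rfl⟩) | ⟨q, -, rfl | rfl | rfl⟩ <;> exact id

/-! ### The Fourier transform on the encoded labels -/

theorem isPrimitiveRoot_omega : IsPrimitiveRoot (omega n) (n !) := 
  Complex.isPrimitiveRoot_exp _ (Nat.factorial_ne_zero n)

theorem star_omega_mul : star (omega n) * omega n = 1 := by
  have h := isPrimitiveRoot_omega (n := n).norm'_eq_one (Nat.factorial_ne_zero n)
  rw [mul_comm, Complex.star_def, Complex.mul_conj, Complex.normSq_eq_norm_sq, h]
  simp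

/-- The Fourier transform on `ℤ / n!`. -/
noncomputable def fourierMatrix (n : ℕ) : Matrix (Fin (n !)) (Fin (n !)) ℂ :=
  Matrix.of fun x z => ((1 / Real.sqrt (n !) : ℝ) : ℂ) * omega n ^ ((x : ℕ) * (z : ℕ))

/-- Orthogonality of characters: off the diagonal the entry is a full geometric sum over an `n!`-th
root of unity other than `1`. -/
theorem star_fourierMatrix_mul : (fourierMatrix n)ᴴ * fourierMatrix n = 1 := by
  have hpos : (0 : ℝ) < (n ! : ℝ) := by exact_mod_cast n.factorial_pos
  have hnorm : ((1 / Real.sqrt (n !) : ℝ) : ℂ) * ((1 / Real.sqrt (n !) : ℝ) : ℂ) * (n ! : ℂ) = 1 := by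
    have : (1 / Real.sqrt (n !)) * (1 / Real.sqrt (n !)) * (n ! : ℝ) = 1 := by
      rw [div_mul_div_comm, Real.mul_self_sqrt hpos.le]
      field_simp
    exact_mod_cast this
  have hω := isPrimitiveRoot_omega (n := n)
  ext z z'
  have hterm : ∀ x : Fin (n !), star (fourierMatrix n x z) * fourierMatrix n x z' =
      ((1 / Real.sqrt (n !) : ℝ) : ℂ) * ((1 / Real.sqrt (n !) : ℝ) : ℂ) *
        (star (omega n) ^ (z : ℕ) * omega n ^ (z' : ℕ)) ^ (x : ℕ) := fun x => by
    simp only [fourierMatrix, Matrix.of_apply, star_mul', star_pow, Complex.star_def,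
      Complex.conj_ofReal, mul_pow, ← pow_mul, mul_comm (x : ℕ)]
    ring
  simp only [Matrix.mul_apply, Matrix.conjTranspose_apply, hterm, ← Finset.mul_sum]
  rw [Fin.sum_univ_eq_sum_range fun x => (star (omega n) ^ (z : ℕ) * omega n ^ (z' : ℕ)) ^ x]
  by_cases hz : z = z'
  · subst hz
    simp only [← mul_pow, star_omega_mul, one_pow, Matrix.one_apply_eq]
    simpa using hnorm
  · have hne : star (omega n) ^ (z : ℕ) * omega n ^ (z' : ℕ) ≠ 1 := fun h => by
      refine hz (Fin.ext (hω.pow_inj z.2 z'.2 ?_))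
      calc omega n ^ (z : ℕ) = omega n ^ (z : ℕ) * (star (omega n) ^ (z : ℕ) * omega n ^ (z' : ℕ)) := by
            rw [h, mul_one]
        _ = (star (omega n) * omega n) ^ (z : ℕ) * omega n ^ (z' : ℕ) := by rw [mul_pow]; ring
        _ = omega n ^ (z' : ℕ) := by rw [star_omega_mul, one_pow, one_mul]
    have hroot : (star (omega n) ^ (z : ℕ) * omega n ^ (z' : ℕ)) ^ (n !) = 1 := by
      rw [mul_pow, ← pow_mul, ← pow_mul, mul_comm, mul_comm (z' : ℕ), mul_comm (z : ℕ), pow_mul,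
        pow_mul, ← star_pow, hω.pow_eq_one]
      simp
    have hgeom := geom_sum_mul (star (omega n) ^ (z : ℕ) * omega n ^ (z' : ℕ)) (n !)
    rw [hroot, sub_self] at hgeom
    rw [(mul_eq_zero.mp hgeom).resolve_right (sub_ne_zero.mpr hne), mul_zero,
      Matrix.one_apply_ne hz]

theorem IsEncoding.injective {enc : Fin (n !) → Ctrl n → Bool} (h : IsEncoding enc) :
    Function.Injective enc := fun x z hxz => Fin.ext (by rw [← h x, ← h z, hxz])

/-- The encoded basis vectors are distinct, so the Fourier matrix on their span and the identity on
the remaining basis vectors form a block-diagonal unitary. -/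
theorem IsEncoding.exists_isFourier {enc : Fin (n !) → Ctrl n → Bool} (h : IsEncoding enc) :
    ∃ F, IsFourier enc F := by
  classical
  let e : Fin (n !) ⊕ ((Set.range enc)ᶜ : Set (Ctrl n → Bool)) ≃ (Ctrl n → Bool) :=
    ((Equiv.ofInjective enc h.injective).sumCongr (Equiv.refl _)).trans
      (Equiv.Set.sumCompl (Set.range enc))
  have he : ∀ x, e (.inl x) = enc x := fun x => by simp [e]
  have hunit : Matrix.reindex e e (Matrix.fromBlocks (fourierMatrix n) 0 0 1) ∈
      Matrix.unitaryGroup (Ctrl n → Bool) ℂ := by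
    rw [Matrix.mem_unitaryGroup_iff', Matrix.star_eq_conjTranspose, Matrix.reindex_apply,
      Matrix.conjTranspose_submatrix, Matrix.submatrix_mul_equiv, Matrix.fromBlocks_conjTranspose,
      Matrix.fromBlocks_multiply]
    simp [star_fourierMatrix_mul]
  refine ⟨⟨_, hunit⟩, fun z => ?_⟩
  funext b
  obtain ⟨s, rfl⟩ := e.surjective b
  rw [Matrix.mulVec_single_one, ← he z, Matrix.col_apply]
  change Matrix.fromBlocks (fourierMatrix n) 0 0 1 (e.symm (e s)) (e.symm (e (.inl z))) = _
  rw [Equiv.symm_apply_apply, Equiv.symm_apply_apply]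
  rcases s with x | s
  · simp [he, fourierMatrix, Finset.sum_apply, Pi.single_apply, h.injective.eq_iff]
  · have : ∀ x, (e (.inr s) = enc x) = False := fun x => by simp [← he]
    simp [Finset.sum_apply, this]

/-- Phase estimation: an operator with eigenvalues `ω ^ (x y)` on the encoded numbers `x`, between
two Fourier transforms, returns `y`. -/
theorem IsFourier.onQubits_star {enc : Fin (n !) → Ctrl n → Bool}
    {F : Matrix.unitaryGroup (Ctrl n → Bool) ℂ} (hF : IsFourier enc F) {S : Type} [Fintype S]
    (T : State (Ctrl n) S d →ₗ[ℂ] State (Ctrl n) S d) (ψ ψ' : S → Fin d → ℂ) (y : ℕ) (hy : y < n !)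
    (hT : ∀ x, T (productState (enc x) ψ) = omega n ^ ((x : ℕ) * y) • productState (enc x) ψ') :
    onQubits (star F).1 (T (onQubits F.1 (productState (enc ⟨0, n.factorial_pos⟩) ψ))) =
      productState (enc ⟨y, hy⟩) ψ' := by
  have hF' : ∀ (z : Fin (n !)) (f : S → Fin d → ℂ), onQubits F.1 (productState (enc z) f) =
      ∑ x : Fin (n !), (((1 / Real.sqrt (n !) : ℝ) : ℂ) * omega n ^ ((x : ℕ) * (z : ℕ))) •
        productState (enc x) f := fun z f => by
    refine onQubits_productState _ _ _ _ _ ?_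
    rw [hF z, Finset.smul_sum]
    simp only [smul_smul]
  -- `F|0⟩` is the uniform superposition; the phases produced by `T` are exactly the coefficients of
  -- `F|y⟩`.
  have hmid : T (onQubits F.1 (productState (enc ⟨0, n.factorial_pos⟩) ψ)) =
      onQubits F.1 (productState (enc ⟨y, hy⟩) ψ') := by
    rw [hF', hF', map_sum]
    simp only [map_smul, hT, smul_smul, mul_zero, pow_zero, mul_one]
  have hstar : (star F).1 * F.1 = 1 := Matrix.mem_unitaryGroup_iff'.mp F.2
  rw [hmid, onQubits_mul, hstar, onQubits_one]

/-! ### The words applied by the circuits for fixed control bits -/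

/-- The indices `k - 1` of the boxes `U_k`, `1 ≤ k ≤ n - 1`, that act on the target system `t`, in
increasing order. -/
def targetBoxes (t : Target n) : List (Fin (n - 1)) :=
  (List.finRange (n - 1)).filter fun k => (k : ℕ) % 2 ^ ((t.1 : ℕ) + 1) = t.2

theorem targetWord_eq [NeZero n] (t : Target n) :
    targetWord t = ((targetBoxes t).map boxIndex).reverse ++ [0] := by
  obtain ⟨m, rfl⟩ := Nat.exists_eq_add_of_le' (NeZero.one_le (n := n))
  rw [targetWord, List.finRange_succ, List.filter_cons_of_pos (by simp), List.reverse_cons,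
    List.filter_map]
  refine congrArg (fun l : List (Fin m) => (l.map Fin.succ).reverse ++ [0])
    (List.filter_congr fun k _ => decide_eq_decide.mpr ?_)
  have hne : ¬ k.succ = 0 := Fin.succ_ne_zero k
  have hlt := t.2.2
  have : (k : ℕ) + 1 ≡ (t.2 : ℕ) + 1 [MOD 2 ^ ((t.1 : ℕ) + 1)] ↔
      (k : ℕ) ≡ (t.2 : ℕ) [MOD 2 ^ ((t.1 : ℕ) + 1)] :=
    ⟨Nat.ModEq.add_right_cancel' 1, Nat.ModEq.add_right 1⟩
  simp only [hne, false_or, Fin.val_succ, this]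
  rw [Nat.ModEq, Nat.mod_eq_of_lt hlt]

/-- A target with exponent `i` is reached only through the qubits `c_{k,i}`, so each `k` contributes
at most one gate, in the decreasing order of `ctrlOrder`. -/
theorem filter_ctrlOrder (c : Ctrl n → Bool) (v : Bool) (t : Target n) :
    (((ctrlOrder n).filter fun q => targetOf q = t ∧ c q = v).map fun q => boxIndex q.1) =
      (((targetBoxes t).filter fun k => c (k, t.1) = v).map boxIndex).reverse := by
  have hinner : ∀ k : Fin (n - 1),
      (((List.finRange (Nat.clog 2 n)).map fun i => ((k, i) : Ctrl n)).filter
          fun q => targetOf q = t ∧ c q = v).map (fun q => boxIndex q.1) =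
        if (k : ℕ) % 2 ^ ((t.1 : ℕ) + 1) = t.2 ∧ c (k, t.1) = v then [boxIndex k] else [] := by
    intro k
    obtain ⟨i, j⟩ := t
    have heq : ∀ i', (targetOf (k, i') = ⟨i, j⟩ ∧ c (k, i') = v) ↔
        i' = i ∧ ((k : ℕ) % 2 ^ ((i : ℕ) + 1) = j ∧ c (k, i) = v) := fun i' => by
      by_cases hi : i' = i
      · subst hi
        simp [targetOf, Fin.ext_iff]
      · simp [targetOf, hi]
    rw [List.filter_map, List.map_map]
    simp only [Function.comp_def, heq]
    by_cases hk : (k : ℕ) % 2 ^ ((i : ℕ) + 1) = j ∧ c (k, i) = v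
    · simp only [hk, and_self, and_true, if_true]
      rw [List.map_const', ← List.countP_eq_length_filter]
      have : (List.finRange (Nat.clog 2 n)).countP (fun i' => decide (i' = i)) = 1 :=
        List.count_eq_one_of_mem (List.nodup_finRange _) (List.mem_finRange i)
      rw [this]
      rfl
    · simp [hk]
  rw [ctrlOrder, List.filter_flatMap, List.map_flatMap]
  simp only [hinner]
  rw [targetBoxes, List.filter_filter]
  induction List.finRange (n - 1) with
  | nil => rfl
  | cons k L ih =>
    rw [List.reverse_cons, List.flatMap_append, ih, List.filter_cons]
    by_cases hk : (k : ℕ) % 2 ^ ((t.1 : ℕ) + 1) = t.2 ∧ c (k, t.1) = v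
    · simp [hk]
    · have hk' : ¬ (c (k, t.1) = v ∧ (k : ℕ) % 2 ^ ((t.1 : ℕ) + 1) = t.2) := fun h => hk h.symm
      simp [hk, hk']

/-- The word of the boxes that the circuit applies to the target system `t`. -/
def circuitWord [NeZero n] (c : Ctrl n → Bool) (t : Target n) : List (Fin n) :=
  (((targetBoxes t).filter fun k => !c (k, t.1)).map boxIndex).reverse ++
    0 :: ((targetBoxes t).filter fun k => c (k, t.1)).map boxIndex

theorem circuitWord_mulVec [NeZero n] (U : Fin n → Matrix.unitaryGroup (Fin d) ℂ)
    (c : Ctrl n → Bool) (t : Target n) (f : Fin d → ℂ) :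
    wordProd U (((ctrlOrder n).reverse.filter fun q => targetOf q = t ∧ c q = false).map
        fun q => boxIndex q.1).reverse *ᵥ ((U 0 : Matrix (Fin d) (Fin d) ℂ) *ᵥ
      (wordProd U (((ctrlOrder n).filter fun q => targetOf q = t ∧ c q = true).map
        fun q => boxIndex q.1).reverse *ᵥ f)) = wordProd U (circuitWord c t) *ᵥ f := by
  rw [List.filter_reverse, List.map_reverse, List.reverse_reverse, filter_ctrlOrder,
    filter_ctrlOrder, List.reverse_reverse, Matrix.mulVec_mulVec, Matrix.mulVec_mulVec, circuitWord,
    wordProd_append, wordProd_cons, mul_assoc]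
  simp

theorem circuit_op_productState [NeZero n] (U : Fin n → Matrix.unitaryGroup (Fin d) ℂ)
    (c : Ctrl n → Bool) (ψ : Target n → Fin d → ℂ) :
    (circuit n).op U (productState c ψ) =
      productState c fun t => wordProd U (circuitWord c t) *ᵥ ψ t := by
  rw [circuit, Circuit.op_append, Circuit.op_append, op_map_ctrlQuery,
    op_map_query U 0 c _ nodup_allTargets, op_map_ctrlQuery]
  simp only [mem_allTargets, if_true, circuitWord_mulVec]

theorem op_map_query_inl [NeZero n] (U : Fin n → Matrix.unitaryGroup (Fin d) ℂ)
    (c : Ctrl n → Bool) (ψ : Target n → Fin d → ℂ) (a : Aux n → Fin d → ℂ) :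
    Circuit.op U ((allTargets n).map fun t => (.query 0 (.inl t) : Gate n _ (Target n ⊕ Aux n)))
        (productState c (Sum.elim ψ a)) =
      productState c (Sum.elim (fun t => (U 0 : Matrix (Fin d) (Fin d) ℂ) *ᵥ ψ t) a) := by
  have h := op_map_query U 0 c ((allTargets n).map (Sum.inl : Target n → Target n ⊕ Aux n))
    (nodup_allTargets.map Sum.inl_injective) (Sum.elim ψ a)
  rw [List.map_map] at h
  refine h.trans (congrArg _ (funext fun s => ?_))
  rcases s with t | k <;> simp [mem_allTargets]

/-- For each `i` the qubit `c_{k,i}` differs from the control value in exactly one of the two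
halves, so `a_k` receives one query per `i`, whatever `c` is. -/
theorem countP_ctrlOrder (c : Ctrl n → Bool) (k : Aux n) :
    ((ctrlOrder n).countP fun q => q.1 = k ∧ c q ≠ true) +
      ((ctrlOrder n).reverse.countP fun q => q.1 = k ∧ c q ≠ false) = Nat.clog 2 n := by
  have hadd : ∀ L : List (Ctrl n), (L.countP fun q => q.1 = k ∧ c q ≠ true) +
      (L.countP fun q => q.1 = k ∧ c q ≠ false) = L.countP fun q => q.1 = k := fun L => by
    induction L with
    | nil => rfl
    | cons q L ih =>
      rw [List.countP_cons, List.countP_cons, List.countP_cons, ← ih]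
      by_cases hk : q.1 = k <;> cases c q <;> simp [hk] <;> omega
  have hinner : ∀ k' : Fin (n - 1),
      (((List.finRange (Nat.clog 2 n)).map fun i => ((k', i) : Ctrl n)).countP fun q => q.1 = k) =
        if k' = k then Nat.clog 2 n else 0 := fun k' => by
    by_cases hk : k' = k <;> simp [List.countP_map, Function.comp_def, hk]
  rw [List.countP_reverse, hadd, ctrlOrder, List.countP_flatMap]
  simp only [Function.comp_def, hinner]
  rw [List.map_reverse, List.sum_reverse, ← Fin.sum_univ_def]
  simp

theorem swapCircuit_op_productState [NeZero n] (U : Fin n → Matrix.unitaryGroup (Fin d) ℂ)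
    (c : Ctrl n → Bool) (ψ : Target n → Fin d → ℂ) (a : Aux n → Fin d → ℂ) :
    (swapCircuit n).op U (productState c (Sum.elim ψ a)) =
      productState c (Sum.elim (fun t => wordProd U (circuitWord c t) *ᵥ ψ t) (auxFinal U a)) := by
  rw [swapCircuit, Circuit.op_append, Circuit.op_append, op_flatMap_swapGates, op_map_query_inl,
    op_flatMap_swapGates]
  simp only [circuitWord_mulVec]
  congr 2
  funext k
  rw [Matrix.mulVec_mulVec, ← pow_add, add_comm, countP_ctrlOrder, auxFinal]

/-! ### The accumulated phase -/

theorem countP_targetBoxes (t : Target n) (k : Fin (n - 1)) (hk : k ∈ targetBoxes t) :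
    (targetBoxes t).countP (fun j => boxIndex j < boxIndex k) =
      (k : ℕ) / 2 ^ ((t.1 : ℕ) + 1) := by
  have hkt : (k : ℕ) % 2 ^ ((t.1 : ℕ) + 1) = t.2 := by simpa using (List.mem_filter.mp hk).2
  have hcount := Nat.count_modEq_card (k : ℕ) (by positivity : 0 < 2 ^ ((t.1 : ℕ) + 1)) (k : ℕ)
  -- The boundary term of the count appears only if the residue counted is below that of `k`; here
  -- the two coincide.
  rw [if_neg (lt_irrefl _), add_zero, Nat.count_eq_card_filter_range] at hcount
  rw [← hcount, targetBoxes, List.countP_filter, List.countP_eq_length_filter,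
    ← List.toFinset_card_of_nodup ((List.nodup_finRange _).filter _)]
  have hlt : ∀ j : Fin (n - 1), boxIndex j < boxIndex k ↔ (j : ℕ) < k := fun j =>
    Nat.succ_lt_succ_iff
  refine Finset.card_bij (fun j _ => (j : ℕ)) ?_ (fun i _ j _ h => Fin.ext h) ?_
  · intro j hj
    simp only [List.mem_toFinset, List.mem_filter, List.mem_finRange, true_and, Bool.and_eq_true,
      decide_eq_true_eq, hlt] at hj
    exact Finset.mem_filter.mpr ⟨Finset.mem_range.mpr hj.1, hj.2.trans hkt.symm⟩
  · intro j hj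
    obtain ⟨hjk, hmod⟩ := Finset.mem_filter.mp hj
    have hjk := Finset.mem_range.mp hjk
    refine ⟨⟨j, hjk.trans k.2⟩, ?_, rfl⟩
    simp only [List.mem_toFinset, List.mem_filter, List.mem_finRange, true_and, Bool.and_eq_true,
      decide_eq_true_eq, hlt]
    exact ⟨hjk, Eq.trans hmod hkt⟩

theorem Commutation.wordProd_circuitWord [NeZero n] {U : Fin n → Matrix.unitaryGroup (Fin d) ℂ}
    {y : ℕ} (h : Commutation U y) (c : Ctrl n → Bool) (t : Target n) :
    wordProd U (circuitWord c t) =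
      omega n ^ ((∑ k : Fin (n - 1), if (k : ℕ) % 2 ^ ((t.1 : ℕ) + 1) = t.2 then
          (c (k, t.1)).toNat * ((k : ℕ) / 2 ^ ((t.1 : ℕ) + 1) + 1) * ((k : ℕ) + 1)! else 0) * y) •
        wordProd U (targetWord t) := by
  have hsum : ∀ (L : List (Fin (n - 1))) (p : Fin (n - 1) → Prop) [DecidablePred p]
      (g : Fin (n - 1) → ℕ), ((L.filter p).map g).sum = (L.map fun k => if p k then g k else 0).sum := by
    intro L p _ g
    induction L with
    | nil => rfl
    | cons k L ih => by_cases hk : p k <;> simp [hk, ih]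
  rw [circuitWord, h.wordProd_filter, targetWord_eq, Fin.sum_univ_def, ← hsum]
  · congr 4
    refine List.map_congr_left fun k hk => ?_
    rw [countP_targetBoxes t k hk]
    rfl
  · refine List.Pairwise.filter _ ((List.pairwise_lt_finRange _).imp fun hij => ?_)
    simpa [boxIndex] using hij
  · intro k _
    simp [Fin.lt_def, boxIndex]

/-- The phases are kept as one scalar per target system, since only their product is meaningful for
the joint state. -/
theorem Commutation.productState_circuitWord [NeZero n]
    {U : Fin n → Matrix.unitaryGroup (Fin d) ℂ} {y : ℕ} (h : Commutation U y)
    (c : Ctrl n → Bool) (ψ : Target n → Fin d → ℂ) :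
    ∃ r : Target n → ℂ, ∏ t, r t = omega n ^ (bitValue c * y) ∧
      (fun t => wordProd U (circuitWord c t) *ᵥ ψ t) = fun t => r t • targetFinal U ψ t := by
  refine ⟨_, ?_, funext fun t => by rw [h.wordProd_circuitWord, Matrix.smul_mulVec, targetFinal]⟩
  rw [Finset.prod_pow_eq_pow_sum, ← Finset.sum_mul, bitValue_eq, Fintype.sum_sigma,
    Finset.sum_comm (s := (Finset.univ : Finset (Fin (n - 1))))]
  congr 2
  refine Finset.sum_congr rfl fun i _ => ?_
  rw [Finset.sum_comm]
  refine Finset.sum_congr rfl fun k _ => ?_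
  -- Within the family `i`, the qubit `c_{k,i}` belongs to exactly one system, so a single `j`
  -- survives in the sum.
  have : ∀ j : Fin (2 ^ ((i : ℕ) + 1)), ((k : ℕ) % 2 ^ ((i : ℕ) + 1) = j) ↔
      (⟨(k : ℕ) % 2 ^ ((i : ℕ) + 1), Nat.mod_lt _ (by positivity)⟩ : Fin _) = j := fun j => by
    rw [Fin.ext_iff]
  simp only [this, Finset.sum_ite_eq, Finset.mem_univ, if_true]

theorem FactoradicPromise.circuit_op [NeZero n] {U : Fin n → Matrix.unitaryGroup (Fin d) ℂ} {y : ℕ}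
    (h : FactoradicPromise U y) (c : Ctrl n → Bool) (ψ : Target n → Fin d → ℂ) :
    (circuit n).op U (productState c ψ) =
      omega n ^ (bitValue c * y) • productState c (targetFinal U ψ) := by
  obtain ⟨r, hr, hψ⟩ := h.commutation.productState_circuitWord c ψ
  rw [circuit_op_productState, hψ, productState_smul, hr]

theorem FactoradicPromise.swapCircuit_op [NeZero n] {U : Fin n → Matrix.unitaryGroup (Fin d) ℂ}
    {y : ℕ} (h : FactoradicPromise U y) (c : Ctrl n → Bool) (ψ : Target n → Fin d → ℂ)
    (a : Aux n → Fin d → ℂ) :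
    (swapCircuit n).op U (productState c (Sum.elim ψ a)) =
      omega n ^ (bitValue c * y) •
        productState c (Sum.elim (targetFinal U ψ) (auxFinal U a)) := by
  obtain ⟨r, hr, hψ⟩ := h.commutation.productState_circuitWord c ψ
  -- The auxiliary systems carry no phase, hence the scalar `1`.
  have hsum := productState_smul c (Sum.elim r fun _ => 1)
    (Sum.elim (targetFinal U ψ) (auxFinal U a))
  rw [Fintype.prod_sum_type] at hsum
  simp only [Sum.elim_inl, Sum.elim_inr, Finset.prod_const_one, mul_one, hr] at hsum
  rw [swapCircuit_op_productState, hψ, ← hsum]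
  congr 1
  funext s
  rcases s with t | k <;> simp

end FPP

theorem mainTheorem2 :
    (∀ (n : ℕ) [NeZero n],
      -- the size of the register
      Fintype.card (Ctrl n) = (n - 1) * Nat.clog 2 n ∧
      Fintype.card (Target n) = 2 ^ (Nat.clog 2 n + 1) - 2 ∧
      -- the query complexity
      (circuit n).queries = 2 * (n - 1) * Nat.clog 2 n + 2 ^ (Nat.clog 2 n + 1) - 2 ∧
      (swapCircuit n).queries = 2 * (n - 1) * Nat.clog 2 n + 2 ^ (Nat.clog 2 n + 1) - 2 ∧
      ((circuit n).queries : ℝ) < 2 * ((n : ℝ) - 1) * (Real.logb 2 n + 1) + 4 * n - 2 ∧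
      -- the second circuit does not control unknown unitaries
      (∀ g ∈ swapCircuit n, ¬ g.ControlsUnknown) ∧
      -- every label is represented by a state of the control qubits
      (∀ x < n !, ∃ c : Ctrl n → Bool, bitValue c = x) ∧
      (∀ enc : Fin (n !) → Ctrl n → Bool, IsEncoding enc → ∃ F, IsFourier enc F) ∧
      ∀ (d : ℕ) (U : Fin n → Matrix.unitaryGroup (Fin d) ℂ) (y : ℕ) (hy : y < n !),
        -- the promise is equivalent to the pairwise commutation relations
        (FactoradicPromise U y ↔ ∀ j k : Fin n, j < k →
          (U j * U k : Matrix (Fin d) (Fin d) ℂ) =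
            omega n ^ ((k : ℕ)! * y) • (U k * U j : Matrix (Fin d) (Fin d) ℂ)) ∧
        (FactoradicPromise U y →
          -- the transformation with controlled black boxes
          (∀ (c : Ctrl n → Bool) (ψ : Target n → Fin d → ℂ),
            (circuit n).op U (productState c ψ) =
              omega n ^ (bitValue c * y) • productState c (targetFinal U ψ)) ∧
          -- the transformation with controlled swaps
          (∀ (c : Ctrl n → Bool) (ψ : Target n → Fin d → ℂ) (a : Aux n → Fin d → ℂ),
            (swapCircuit n).op U (productState c (Sum.elim ψ a)) =
              omega n ^ (bitValue c * y) •
                productState c (Sum.elim (targetFinal U ψ) (auxFinal U a))) ∧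
          -- both circuits, between two Fourier transforms of the control register, return `y`
          (∀ (enc : Fin (n !) → Ctrl n → Bool) (F : Matrix.unitaryGroup (Ctrl n → Bool) ℂ),
            IsEncoding enc → IsFourier enc F →
            (∀ ψ : Target n → Fin d → ℂ,
              onQubits (star F).1 ((circuit n).op U
                (onQubits F.1 (productState (enc ⟨0, n.factorial_pos⟩) ψ))) =
                productState (enc ⟨y, hy⟩) (targetFinal U ψ)) ∧
            (∀ (ψ : Target n → Fin d → ℂ) (a : Aux n → Fin d → ℂ),
              onQubits (star F).1 ((swapCircuit n).op U
                (onQubits F.1 (productState (enc ⟨0, n.factorial_pos⟩) (Sum.elim ψ a)))) =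
                productState (enc ⟨y, hy⟩) (Sum.elim (targetFinal U ψ) (auxFinal U a)))))) ∧
    -- the query complexity is `O(n log n)`
    (∃ C : ℝ, ∀ (n : ℕ) [NeZero n],
      ((circuit n).queries : ℝ) ≤ C * (n * Real.logb 2 n) ∧
      ((swapCircuit n).queries : ℝ) ≤ C * (n * Real.logb 2 n)) := by
  refine ⟨fun n _ => ⟨card_ctrl, card_target, circuit_queries, swapCircuit_queries, ?_,
    not_controlsUnknown_of_mem_swapCircuit, exists_bitValue_eq, fun enc h => h.exists_isFourier,
    fun d U y hy => ⟨factoradicPromise_iff, fun h => ⟨h.circuit_op, h.swapCircuit_op,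
      fun enc F henc hF => ⟨fun ψ => ?_, fun ψ a => ?_⟩⟩⟩⟩, 8, fun n _ => ⟨?_, ?_⟩⟩
  · rw [circuit_queries]
    exact queries_lt
  · exact hF.onQubits_star _ _ _ y hy fun x => by rw [h.circuit_op, henc x]
  · exact hF.onQubits_star _ _ _ y hy fun x => by rw [h.swapCircuit_op, henc x]
  · rw [circuit_queries]
    exact queries_le
  · rw [swapCircuit_queries]
    exact queries_le
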